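/- A complete metric space $(Y,d_Y)$ is called a CAT(0) space if for all $x,y\in Y$ and $t\in[0,1]$ there is $z\in Y$ with $$d_Y(w,z)^2\le (1-t)\,d_Y(w,x)^2+t\,d_Y(w,y)^2-t(1-t)\,d_Y(x,y)^2\quad\text{for all } w\in Y.$$ There exists a metric space $(X,d_X)$ with exactly $6$ points that satisfies the following two conditions. (i) $X$ satisfies all Andoni–Naor–Neiman inequalities: for all positive integers $n$ and $m$, all points $x_1,\dots,x_n\in X$, all positive real numbers $c_1,\dots,c_m$, all positive real numbers $p_i^k,q_j^k$ ($k\in\{1,\dots,m\}$, $i,j\in\{1,\dots,n\}$) with $\sum_{i=1}^n p_i^k=\sum_{j=1}^n q_j^k=1$ for every $k$, and all $n\times n$ matrices $A_k=(a_{ij}^k)$, $B_k=(b_{ij}^k)$ ($k\in\{1,\dots,m\}$) with nonnegative real entries such that $$\sum_{s=1}^n a_{is}^k+\sum_{s=1}^n b_{sj}^k=p_i^k+q_j^k\qquad\text{for all } i,j\in\{1,\dots,n\}\text{ and all }k,$$ one has $$\sum_{k=1}^m\ \sum_{\substack{1\le i,j\le n\\ a_{ij}^k+b_{ij}^k>0}}\frac{c_k\,a_{ij}^k\,b_{ij}^k}{a_{ij}^k+b_{ij}^k}\,d_X(x_i,x_j)^2\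 \le\ \sum_{k=1}^m\sum_{i=1}^n\sum_{j=1}^n c_k\,p_i^k\,q_j^k\,d_X(x_i,x_j)^2 .$$ (ii) $X$ does not admit an isometric embedding into any CAT(0) space. -/

import Mathlib

open scoped BigOperators

/-- A complete metric space `Y` is a CAT(0) space if for all `x y : Y` and all `t ∈ [0,1]` there is
a point `z` with
`d(w,z)² ≤ (1-t) d(w,x)² + t d(w,y)² - t(1-t) d(x,y)²` for every `w : Y`. -/
def IsCAT0 (Y : Type*) [MetricSpace Y] : Prop :=
  CompleteSpace Y ∧
    ∀ x y : Y, ∀ t : ℝ, 0 ≤ t → t ≤ 1 →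
      ∃ z : Y, ∀ w : Y,
        dist w z ^ 2 ≤
          (1 - t) * dist w x ^ 2 + t * dist w y ^ 2 - t * (1 - t) * dist x y ^ 2

/-- The admissible parameters of the Andoni–Naor–Neiman family for `n` points and `m` blocks:
positive weights `c k`, vectors `p k`, `q k` with positive entries summing to one, and matrices
`A k`, `B k` with nonnegative entries such that
`∑ₛ (A k)ᵢₛ + ∑ₛ (B k)ₛⱼ = (p k)ᵢ + (q k)ⱼ` for all `i`, `j`. -/
structure IsANNParameters {n m : ℕ} (c : Fin m → ℝ) (p q : Fin m → Fin n → ℝ)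
    (A B : Fin m → Matrix (Fin n) (Fin n) ℝ) : Prop where
  c_pos : ∀ k, 0 < c k
  p_pos : ∀ k i, 0 < p k i
  q_pos : ∀ k i, 0 < q k i
  sum_p : ∀ k, ∑ i, p k i = 1
  sum_q : ∀ k, ∑ j, q k j = 1
  A_nonneg : ∀ k i j, 0 ≤ A k i j
  B_nonneg : ∀ k i j, 0 ≤ B k i j
  marginal : ∀ k i j, ∑ s, A k i s + ∑ s, B k s j = p k i + q k j

/-- The Andoni–Naor–Neiman inequality with parameters `c, p, q, A, B` at the points
`x 0, …, x (n-1)`; on the left, `(i,j)` runs over the pairs with `(A k)ᵢⱼ + (B k)ᵢⱼ > 0`. -/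
def ANNInequality {X : Type*} [MetricSpace X] {n m : ℕ} (c : Fin m → ℝ) (p q : Fin m → Fin n → ℝ)
    (A B : Fin m → Matrix (Fin n) (Fin n) ℝ) (x : Fin n → X) : Prop :=
  ∑ k, ∑ i, ∑ j with 0 < A k i j + B k i j,
      c k * A k i j * B k i j / (A k i j + B k i j) * dist (x i) (x j) ^ 2 ≤
    ∑ k, ∑ i, ∑ j, c k * p k i * q k j * dist (x i) (x j) ^ 2

/-! The space is almost Euclidean: a map to ℝ³ preserves every distance except one, since it
collapses the pair `2`, `3`; composed with a symmetry of the space, it collapses `0`, `1` instead.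
For the inequalities, let `r i` be the distance from the image of `x i` to the `p`-barycenter. The
collapsed pair needs `r i + r j ≥ 24`, which holds when the barycenter lies in the half-space away
from that pair; otherwise the symmetric map serves (`exists_radius`). In a CAT(0) space, however,
both pairs have midpoints, and the path from `4` to `5` through them would be shorter than 72. -/

theorem le_of_sq_le_sq_of_nonneg {a b : ℝ} (h : a ^ 2 ≤ b ^ 2) (hb : 0 ≤ b) : a ≤ b :=
  (abs_le_of_sq_le_sq' h hb).2

/-- If the points `x i` admit radii `r i` satisfying the triangle inequality
`dist (x i) (x j) ≤ r i + r j` whose weighted square sum is bounded by the mean square distance, for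
each choice of the weights, then all Andoni–Naor–Neiman inequalities hold at `x`. -/
theorem annInequality_of_exists_radius {X : Type*} [MetricSpace X] {n m : ℕ} {c : Fin m → ℝ}
    {p q : Fin m → Fin n → ℝ} {A B : Fin m → Matrix (Fin n) (Fin n) ℝ} {x : Fin n → X}
    (h : IsANNParameters c p q A B)
    (hr : ∀ k, ∃ r : Fin n → ℝ, (∀ i j, dist (x i) (x j) ≤ r i + r j) ∧
      ∑ i, (p k i + q k i) * r i ^ 2 ≤ ∑ i, ∑ j, p k i * q k j * dist (x i) (x j) ^ 2) :
    ANNInequality c p q A B x := by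
  refine Finset.sum_le_sum fun k _ => ?_
  obtain ⟨r, hd, hs⟩ := hr k
  have hc := (h.c_pos k).le
  have key : ∑ i, ∑ j, (A k i j * r i ^ 2 + B k i j * r j ^ 2)
      = ∑ i, (p k i + q k i) * r i ^ 2 := by
    simp_rw [Finset.sum_add_distrib]
    rw [Finset.sum_comm (f := fun i j => B k i j * r j ^ 2), ← Finset.sum_add_distrib]
    refine Finset.sum_congr rfl fun i _ => ?_
    rw [← h.marginal k i i, add_mul, Finset.sum_mul, Finset.sum_mul]
  have term : ∀ i j, 0 < A k i j + B k i j →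
      c k * A k i j * B k i j / (A k i j + B k i j) * dist (x i) (x j) ^ 2
        ≤ c k * (A k i j * r i ^ 2 + B k i j * r j ^ 2) := by
    intro i j hpos
    have ha := h.A_nonneg k i j
    have hb := h.B_nonneg k i j
    have h1 : dist (x i) (x j) ^ 2 ≤ (r i + r j) ^ 2 :=
      pow_le_pow_left₀ dist_nonneg (hd i j) 2
    have h2 : A k i j * B k i j * (r i + r j) ^ 2
        ≤ (A k i j * r i ^ 2 + B k i j * r j ^ 2) * (A k i j + B k i j) := by
      -- The two sides differ by exactly this square.
      nlinarith [sq_nonneg (A k i j * r i - B k i j * r j)]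
    rw [div_mul_eq_mul_div, div_le_iff₀ hpos]
    calc c k * A k i j * B k i j * dist (x i) (x j) ^ 2
        = c k * (A k i j * B k i j * dist (x i) (x j) ^ 2) := by ring
      _ ≤ c k * ((A k i j * r i ^ 2 + B k i j * r j ^ 2) * (A k i j + B k i j)) :=
          mul_le_mul_of_nonneg_left
            ((mul_le_mul_of_nonneg_left h1 (mul_nonneg ha hb)).trans h2) hc
      _ = _ := by ring
  calc ∑ i, ∑ j with 0 < A k i j + B k i j,
        c k * A k i j * B k i j / (A k i j + B k i j) * dist (x i) (x j) ^ 2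
      ≤ ∑ i, ∑ j, c k * (A k i j * r i ^ 2 + B k i j * r j ^ 2) := by
        refine Finset.sum_le_sum fun i _ => ?_
        refine (Finset.sum_le_sum fun j hj => term i j (Finset.mem_filter.mp hj).2).trans ?_
        refine Finset.sum_le_sum_of_subset_of_nonneg (Finset.filter_subset _ _) fun j _ _ => ?_
        have ha := h.A_nonneg k i j
        have hb := h.B_nonneg k i j
        positivity
    _ = c k * ∑ i, (p k i + q k i) * r i ^ 2 := by
        rw [← key]; simp_rw [Finset.mul_sum]
    _ ≤ c k * ∑ i, ∑ j, p k i * q k j * dist (x i) (x j) ^ 2 :=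
        mul_le_mul_of_nonneg_left hs hc
    _ = ∑ i, ∑ j, c k * p k i * q k j * dist (x i) (x j) ^ 2 := by
        simp_rw [Finset.mul_sum, mul_assoc]

/-- The parallel axis theorem: the mean square distance to `y` is the square distance from `y` to
the barycenter plus the variance. -/
theorem sum_mul_dist_sq_eq {E : Type*} [NormedAddCommGroup E] [InnerProductSpace ℝ E] {ι : Type*}
    [Fintype ι] {p : ι → ℝ} (hp : ∑ i, p i = 1) (f : ι → E) (y : E) :
    ∑ i, p i * dist (f i) y ^ 2
      = dist y (∑ i, p i • f i) ^ 2 + ∑ i, p i * dist (f i) (∑ i, p i • f i) ^ 2 := by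
  set z := ∑ i, p i • f i with hz
  have hcross : ∑ i, p i * inner ℝ (f i - z) (z - y) = 0 := by
    have h0 : ∑ i, p i • (f i - z) = 0 := by
      simp_rw [smul_sub]
      rw [Finset.sum_sub_distrib, ← Finset.sum_smul, hp, one_smul, sub_eq_zero]
    calc ∑ i, p i * inner ℝ (f i - z) (z - y)
        = inner ℝ (∑ i, p i • (f i - z)) (z - y) := by
          rw [sum_inner]
          exact Finset.sum_congr rfl fun i _ => (real_inner_smul_left _ _ _).symm
      _ = 0 := by rw [h0, inner_zero_left]
  have hterm : ∀ i, p i * dist (f i) y ^ 2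
      = p i * dist (f i) z ^ 2 + 2 * (p i * inner ℝ (f i - z) (z - y)) + p i * dist y z ^ 2 := by
    intro i
    rw [dist_eq_norm, dist_eq_norm, dist_comm y z, dist_eq_norm z y,
      ← sub_add_sub_cancel (f i) z y, norm_add_sq_real]
    ring
  simp_rw [hterm, Finset.sum_add_distrib, ← Finset.mul_sum, hcross, ← Finset.sum_mul, hp]
  ring

/-- Average the parallel axis theorem at `y = f j` with the weights `q j`. -/
theorem sum_mul_dist_barycenter_sq_eq {E : Type*} [NormedAddCommGroup E] [InnerProductSpace ℝ E]
    {ι : Type*} [Fintype ι] {p q : ι → ℝ} (hp : ∑ i, p i = 1) (hq : ∑ i, q i = 1) (f : ι → E) :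
    ∑ i, (p i + q i) * dist (f i) (∑ i, p i • f i) ^ 2
      = ∑ i, ∑ j, p i * q j * dist (f i) (f j) ^ 2 := by
  have h : ∑ i, ∑ j, p i * q j * dist (f i) (f j) ^ 2
      = ∑ j, q j * ∑ i, p i * dist (f i) (f j) ^ 2 := by
    rw [Finset.sum_comm]
    simp_rw [Finset.mul_sum]
    exact Finset.sum_congr rfl fun j _ => Finset.sum_congr rfl fun i _ => by ring
  rw [h, Finset.sum_congr rfl fun j _ => congrArg (q j * ·) (sum_mul_dist_sq_eq hp f (f j))]
  simp_rw [mul_add, Finset.sum_add_distrib, ← Finset.sum_mul, hq, add_mul, Finset.sum_add_distrib]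
  ring

/-- The matrix of squared distances of the six-point space. -/
def sixSq (i j : Fin 6) : ℤ :=
  !![0, 576, 784, 784, 745, 2473;
     576, 0, 784, 784, 745, 2473;
     784, 784, 0, 576, 2473, 745;
     784, 784, 576, 0, 2473, 745;
     745, 745, 2473, 2473, 0, 5184;
     2473, 2473, 745, 745, 5184, 0] i j

theorem sixSq_nonneg : ∀ i j, 0 ≤ sixSq i j := by decide +kernel

theorem sixSq_self : ∀ i, sixSq i i = 0 := by decide +kernel

theorem sixSq_comm : ∀ i j, sixSq i j = sixSq j i := by decide +kernel

theorem eq_of_sixSq_eq_zero : ∀ i j, sixSq i j = 0 → i = j := by decide +kernel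

/-- The triangle inequality for square roots, squared twice so that it is decidable over the
integers. -/
theorem sixSq_triangle : ∀ i j k, sixSq i k ≤ sixSq i j + sixSq j k ∨
    (sixSq i k - sixSq i j - sixSq j k) ^ 2 ≤ 4 * (sixSq i j * sixSq j k) := by decide +kernel

theorem sqrt_le_sqrt_add_sqrt {a b c : ℝ} (hb : 0 ≤ b) (hc : 0 ≤ c)
    (h : a ≤ b + c ∨ (a - b - c) ^ 2 ≤ 4 * (b * c)) : √a ≤ √b + √c := by
  refine (Real.sqrt_le_left (by positivity)).mpr ?_
  have hbc : (√b * √c) ^ 2 = b * c := by rw [mul_pow, Real.sq_sqrt hb, Real.sq_sqrt hc]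
  have hnn : 0 ≤ √b * √c := by positivity
  rw [add_sq, Real.sq_sqrt hb, Real.sq_sqrt hc]
  rcases h with h | h
  · linarith
  · have : a - b - c ≤ 2 * (√b * √c) := le_of_sq_le_sq_of_nonneg (by linarith) (by positivity)
    linarith

/-- The distance function of the six-point space. -/
noncomputable def sixDist (i j : Fin 6) : ℝ := √(sixSq i j)

theorem sixDist_sq (i j : Fin 6) : sixDist i j ^ 2 = sixSq i j :=
  Real.sq_sqrt (mod_cast sixSq_nonneg i j)

theorem sixDist_nonneg (i j : Fin 6) : 0 ≤ sixDist i j := Real.sqrt_nonneg _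

/-- The underlying set of the six-point space. -/
def SixPoint : Type := Fin 6

noncomputable instance : MetricSpace SixPoint where
  dist := sixDist
  dist_self i := by
    change √(sixSq i i : ℝ) = 0
    rw [sixSq_self i, Int.cast_zero, Real.sqrt_zero]
  dist_comm i j := congrArg (fun a : ℤ => √(a : ℝ)) (sixSq_comm i j)
  dist_triangle i j k :=
    sqrt_le_sqrt_add_sqrt (mod_cast sixSq_nonneg i j) (mod_cast sixSq_nonneg j k)
      (mod_cast sixSq_triangle i j k)
  eq_of_dist_eq_zero {i j} h := by
    refine eq_of_sixSq_eq_zero i j ?_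
    have h0 := (Real.sqrt_eq_zero (mod_cast sixSq_nonneg i j)).mp h
    exact_mod_cast h0

/-- A map into Euclidean space preserving all distances except the one between the points `2` and
`3`, which are identified. -/
noncomputable def sixMap : Fin 6 → EuclideanSpace ℝ (Fin 3) :=
  ![!₂[24, 5, 12], !₂[24, 5, -12], !₂[48, 13, 0], !₂[48, 13, 0], !₂[0, 0, 0], !₂[72, 0, 0]]

/-- The symmetry of the six-point space exchanging the pairs `{0, 1}`, `{2, 3}` and the points
`4`, `5`. -/
def sixSymm : Fin 6 → Fin 6 := ![2, 3, 0, 1, 5, 4]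

theorem sixSq_symm : ∀ i j, sixSq (sixSymm i) (sixSymm j) = sixSq i j := by decide +kernel

theorem sixDist_symm (i j : Fin 6) : sixDist (sixSymm i) (sixSymm j) = sixDist i j :=
  congrArg (fun a : ℤ => √(a : ℝ)) (sixSq_symm i j)

theorem sixMap_symm_add (i : Fin 6) : sixMap (sixSymm i) 0 + sixMap i 0 = 72 := by
  fin_cases i <;> simp [sixMap, sixSymm] <;> norm_num

theorem dist_sixMap (i j : Fin 6) : dist (sixMap i) (sixMap j) = sixDist i j ∨
    sixDist i j = 24 ∧ sixMap i = !₂[48, 13, 0] ∧ sixMap j = !₂[48, 13, 0] := by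
  have h24 : √(576 : ℝ) = 24 := by
    rw [show (576 : ℝ) = 24 ^ 2 by norm_num, Real.sqrt_sq (by norm_num)]
  by_cases hij : (i = 2 ∧ j = 3) ∨ (i = 3 ∧ j = 2)
  · right
    rcases hij with ⟨rfl, rfl⟩ | ⟨rfl, rfl⟩ <;> simp [sixDist, sixSq, sixMap, h24]
  · left
    rw [EuclideanSpace.dist_eq, sixDist, Fin.sum_univ_three]
    congr 1
    simp only [Real.dist_eq, sq_abs]
    fin_cases i <;> fin_cases j <;> simp at hij <;> simp [sixMap, sixSq] <;> norm_num

theorem dist_sixMap_le (i j : Fin 6) : dist (sixMap i) (sixMap j) ≤ sixDist i j := by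
  rcases dist_sixMap i j with h | ⟨-, h1, h2⟩
  · exact h.le
  · rw [h1, h2, dist_self]
    exact sixDist_nonneg i j

theorem exists_radius_of_le {n : ℕ} {p q : Fin n → ℝ} (hp : ∀ i, 0 ≤ p i) (hq : ∀ i, 0 ≤ q i)
    (hp1 : ∑ i, p i = 1) (hq1 : ∑ i, q i = 1) (x : Fin n → Fin 6)
    (hx : ∑ i, p i * sixMap (x i) 0 ≤ 36) :
    ∃ r : Fin n → ℝ, (∀ i j, sixDist (x i) (x j) ≤ r i + r j) ∧
      ∑ i, (p i + q i) * r i ^ 2 ≤ ∑ i, ∑ j, p i * q j * sixDist (x i) (x j) ^ 2 := by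
  set z := ∑ i, p i • sixMap (x i) with hz
  refine ⟨fun i => dist (sixMap (x i)) z, fun i j => ?_, ?_⟩
  · beta_reduce
    rcases dist_sixMap (x i) (x j) with h | ⟨h1, h2, h3⟩
    · rw [← h]
      exact dist_triangle_right _ _ _
    · have hz0 : z 0 ≤ 36 := by simpa [hz] using hx
      -- The first coordinates already differ by at least 48 - 36 = 12, half the lost distance 24.
      have h4 : 12 ≤ dist (!₂[48, 13, 0] : EuclideanSpace ℝ (Fin 3)) z := by
        refine le_trans ?_ (PiLp.dist_apply_le (p := 2) _ _ 0)
        rw [Real.dist_eq]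
        refine le_trans ?_ (le_abs_self _)
        simp only [Matrix.cons_val_zero]
        linarith
      rw [h1, h2, h3]
      linarith
  · rw [sum_mul_dist_barycenter_sq_eq hp1 hq1 fun i => sixMap (x i)]
    refine Finset.sum_le_sum fun i _ => Finset.sum_le_sum fun j _ => ?_
    exact mul_le_mul_of_nonneg_left (pow_le_pow_left₀ dist_nonneg (dist_sixMap_le _ _) 2)
      (mul_nonneg (hp i) (hq j))

theorem exists_radius {n : ℕ} {p q : Fin n → ℝ} (hp : ∀ i, 0 ≤ p i) (hq : ∀ i, 0 ≤ q i)
    (hp1 : ∑ i, p i = 1) (hq1 : ∑ i, q i = 1) (x : Fin n → Fin 6) :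
    ∃ r : Fin n → ℝ, (∀ i j, sixDist (x i) (x j) ≤ r i + r j) ∧
      ∑ i, (p i + q i) * r i ^ 2 ≤ ∑ i, ∑ j, p i * q j * sixDist (x i) (x j) ^ 2 := by
  by_cases hx : ∑ i, p i * sixMap (x i) 0 ≤ 36
  · exact exists_radius_of_le hp hq hp1 hq1 x hx
  -- The symmetry reflects first coordinates in 36, so the new barycenter lies on the good side.
  · have h := exists_radius_of_le hp hq hp1 hq1 (fun i => sixSymm (x i)) (by
      have : ∑ i, p i * sixMap (sixSymm (x i)) 0 + ∑ i, p i * sixMap (x i) 0 = 72 := by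
        simp_rw [← Finset.sum_add_distrib, ← mul_add, sixMap_symm_add, ← Finset.sum_mul, hp1,
          one_mul]
      linarith)
    simpa only [sixDist_symm] using h

theorem IsCAT0.not_forall_dist_eq_sixDist {Y : Type*} [MetricSpace Y] (hY : IsCAT0 Y)
    (f : Fin 6 → Y) : ¬ ∀ i j, dist (f i) (f j) = sixDist i j := by
  intro hf
  have hd : ∀ i j, dist (f i) (f j) ^ 2 = sixSq i j := fun i j => by rw [hf, sixDist_sq]
  obtain ⟨m, hm⟩ := hY.2 (f 0) (f 1) (1 / 2) (by norm_num) (by norm_num)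
  obtain ⟨m', hm'⟩ := hY.2 (f 2) (f 3) (1 / 2) (by norm_num) (by norm_num)
  have s01 : sixSq 0 1 = 576 := by decide +kernel
  have s23 : sixSq 2 3 = 576 := by decide +kernel
  have s40 : sixSq 4 0 = 745 := by decide +kernel
  have s41 : sixSq 4 1 = 745 := by decide +kernel
  have s52 : sixSq 5 2 = 745 := by decide +kernel
  have s53 : sixSq 5 3 = 745 := by decide +kernel
  have s20 : sixSq 2 0 = 784 := by decide +kernel
  have s21 : sixSq 2 1 = 784 := by decide +kernel
  have s30 : sixSq 3 0 = 784 := by decide +kernel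
  have s31 : sixSq 3 1 = 784 := by decide +kernel
  have s45 : sixSq 4 5 = 5184 := by decide +kernel
  have h4 := hm (f 4)
  have h5 := hm' (f 5)
  have h2 := hm (f 2)
  have h3 := hm (f 3)
  have hmm := hm' m
  rw [hd, hd, hd, s40, s41, s01] at h4
  rw [hd, hd, hd, s52, s53, s23] at h5
  rw [hd, hd, hd, s20, s21, s01] at h2
  rw [hd, hd, hd, s30, s31, s01] at h3
  rw [hd, s23, dist_comm m (f 2), dist_comm m (f 3)] at hmm
  push_cast at h4 h5 h2 h3 hmm
  -- The squares are at most 745 - 144 = 601, twice, and 784 - 144 - 144 = 496; the rounded bounds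
  -- add up to 71.5.
  have e1 : dist (f 4) m ≤ 24.6 := le_of_sq_le_sq_of_nonneg (by linarith) (by norm_num)
  have e2 : dist (f 5) m' ≤ 24.6 := le_of_sq_le_sq_of_nonneg (by linarith) (by norm_num)
  have e3 : dist m m' ≤ 22.3 := le_of_sq_le_sq_of_nonneg (by linarith) (by norm_num)
  have e4 : 72 ≤ dist (f 4) (f 5) := by
    refine le_of_sq_le_sq_of_nonneg ?_ dist_nonneg
    rw [hd, s45]
    norm_num
  have := dist_triangle4 (f 4) m m' (f 5)
  rw [dist_comm m' (f 5)] at this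
  linarith

theorem mainTheorem2 :
    ∃ (X : Type) (_ : MetricSpace X), Nat.card X = 6 ∧
      (∀ n : ℕ, 0 < n → ∀ x : Fin n → X,
        ∀ m : ℕ, 0 < m → ∀ (c : Fin m → ℝ) (p q : Fin m → Fin n → ℝ)
          (A B : Fin m → Matrix (Fin n) (Fin n) ℝ),
          IsANNParameters c p q A B → ANNInequality c p q A B x) ∧
      (∀ (Y : Type*) [MetricSpace Y], IsCAT0 Y → ¬ ∃ f : X → Y, Isometry f) := by
  refine ⟨SixPoint, inferInstance, Nat.card_fin 6, ?_, ?_⟩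
  · intro n _ x m _ c p q A B h
    exact annInequality_of_exists_radius h fun k =>
      exists_radius (fun i => (h.p_pos k i).le) (fun i => (h.q_pos k i).le) (h.sum_p k) (h.sum_q k) x
  · rintro Y _ hY ⟨f, hf⟩
    exact hY.not_forall_dist_eq_sixDist f fun i j => hf.dist_eq i j
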